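/- Let $k$ be a commutative ring. Let $\mathcal C$ be the category whose objects are the finite sets and in which the set $\mathcal C(Y,X)$ of morphisms from $X$ to $Y$ consists of all subsets of $Y\times X$ (correspondences), with composition $VU=\{(z,x)\mid \exists\, y,\ (z,y)\in V,\ (y,x)\in U\}$ and identities the diagonals $\Delta_X$. Let $k\mathcal C$ be its $k$-linearization: it has the same objects, and $k\mathcal C(Y,X)$ is the free $k$-module with basis $\mathcal C(Y,X)$. A correspondence functor over $k$ is a $k$-linear functor from $k\mathcal C$ to the category of $k$-modules, and a morphism of correspondence functors is a natural transformation. Let $M$ be a correspondence functor over $k$. For a finite set $E$ and a subset $A\subseteq M(E)$, we say that $M$ is generated by $A$ if $M(X)=k\mathcal C(X,E)A$ for every finite set $X$, that is, the $k$-module $M(X)$ is spanned by the elements $fa$ with $f\in k\mathcal C(X,E)$ and $a\in A$. The functor $M$ has bounded type if there is a finite set $E$ such that $M$ is generated by $M(E)$, and $M$ is finitely generated if there are a finite set $E$ and a finite subset $A\subseteq M(E)$ such that $M$ is generated by $A$. For a finite set $E$, the shift $M_E$ is the correspondence functor obtained by precomposing $M$ with the $k$-linear endofunctor of $k\mathcal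 C$ defined by $X\mapsto X\sqcup E$ and $U\mapsto U\sqcup\Delta_E$; so $M_E(X)=M(X\sqcup E)$. A correspondence $V\in\mathcal C(F,E)$ induces a morphism $M_V\colon M_E\to M_F$, given at $X$ by the action of $\Delta_X\sqcup V$. For correspondence functors $M$ and $N$ over $k$, the internal hom $\mathcal H(M,N)$ is the correspondence functor whose value at a finite set $E$ is the $k$-module $\operatorname{Hom}(M,N_E)$ of all morphisms $M\to N_E$, and on which $V\in\mathcal C(F,E)$ acts by composition with $N_V\colon N_E\to N_F$. **Theorem.** Let $M$ and $N$ be correspondence functors over $k$. (a) Let $E$ and $F$ be finite sets. If $M$ is generated by $M(E)$, then $M_F$ is generated by $M_F(E)$. If $M$ has bounded type, so has $M_F$. If $M$ is finitely generated, so is $M_F$. (b) Assume that the ring $k$ is noetherian. If $M$ is finitely generated and $N$ has bounded type (respectively is finitely generated), then $\mathcal H(M,N)$ has bounded type (respectively is finitely generated). -/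

import Mathlib

open CategoryTheory

universe u v w

/-- The composite `V U ⊆ Z × X` of correspondences `V ⊆ Z × Y` and `U ⊆ Y × X`. -/
def corrComp {X Y Z : Type v} (V : Set (Z × Y)) (U : Set (Y × X)) : Set (Z × X) :=
  {p | ∃ y : Y, (p.1, y) ∈ V ∧ (y, p.2) ∈ U}

/-- The disjoint union `U ⊔ V` of correspondences, that is, the block diagonal matrix with
blocks `U` and `V`. -/
def corrSum {X X' E E' : Type v} (U : Set (X' × X)) (V : Set (E' × E)) :
    Set ((X' ⊕ E') × (X ⊕ E)) :=
  {p | (∃ x' x, (x', x) ∈ U ∧ p = (Sum.inl x', Sum.inl x)) ∨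
    (∃ e' e, (e', e) ∈ V ∧ p = (Sum.inr e', Sum.inr e))}

theorem corrSum_id (X E : Type v) :
    corrSum {p : X × X | p.1 = p.2} {p : E × E | p.1 = p.2} = {p | p.1 = p.2} := by
  ext ⟨a | a, b | b⟩ <;> simp [corrSum, eq_comm]

theorem corrSum_comp {X X' X'' E E' E'' : Type v} (U : Set (X' × X)) (U' : Set (X'' × X'))
    (V : Set (E' × E)) (V' : Set (E'' × E')) :
    corrSum (corrComp U' U) (corrComp V' V) = corrComp (corrSum U' V') (corrSum U V) := by
  ext ⟨a | a, b | b⟩ <;> simp [corrSum, corrComp]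

/-- The category `𝒞` of finite sets and correspondences. -/
structure FinCorr : Type (v + 1) where
  carrier : Type v
  [finite : Finite carrier]

namespace FinCorr

attribute [instance] FinCorr.finite

/-- A morphism from `X` to `Y` is a subset of `Y × X`; the identity is the diagonal. -/
instance : Category.{v} FinCorr.{v} where
  Hom X Y := Set (Y.carrier × X.carrier)
  id X := {p | p.1 = p.2}
  comp U V := corrComp V U
  id_comp U := by
    ext ⟨y, x⟩
    simp [corrComp]
  comp_id U := by
    ext ⟨y, x⟩
    simp [corrComp]
  assoc U V T := by
    ext ⟨y, x⟩
    simp only [corrComp, Set.mem_ofPred_eq]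
    grind

/-- The disjoint union `X ⊔ E` of finite sets. -/
def sum (X E : FinCorr.{v}) : FinCorr.{v} := ⟨X.carrier ⊕ E.carrier⟩

/-- `U ⊔ V` as a morphism of the category of finite sets and correspondences. -/
def sumMap {X X' E E' : FinCorr.{v}} (U : X ⟶ X') (V : E ⟶ E') : sum X E ⟶ sum X' E' :=
  corrSum U V

theorem sumMap_id (X E : FinCorr.{v}) : sumMap (𝟙 X) (𝟙 E) = 𝟙 (sum X E) :=
  corrSum_id _ _

theorem sumMap_comp {X X' X'' E E' E'' : FinCorr.{v}} (U : X ⟶ X') (U' : X' ⟶ X'')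
    (V : E ⟶ E') (V' : E' ⟶ E'') :
    sumMap (U ≫ U') (V ≫ V') = sumMap U V ≫ sumMap U' V' :=
  corrSum_comp _ _ _ _

theorem sumMap_swap {X Y E F : FinCorr.{v}} (U : X ⟶ Y) (V : E ⟶ F) :
    sumMap U (𝟙 E) ≫ sumMap (𝟙 Y) V = sumMap (𝟙 X) V ≫ sumMap U (𝟙 F) := by
  rw [← sumMap_comp, ← sumMap_comp]
  simp only [Category.comp_id, Category.id_comp]

/-- The endofunctor `X ↦ X ⊔ E`, `U ↦ U ⊔ Δ_E` of the category of correspondences. -/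
def sumRight (E : FinCorr.{v}) : FinCorr.{v} ⥤ FinCorr.{v} where
  obj X := sum X E
  map U := sumMap U (𝟙 E)
  map_id X := sumMap_id X E
  map_comp U U' := by
    rw [← sumMap_comp, Category.comp_id]

end FinCorr

namespace KLin

variable {k : Type u} [CommRing k]

section general

universe v₁ u₁ v₂ u₂

variable {C : Type u₁} [Category.{v₁} C] {D : Type u₂} [Category.{v₂} D] [Preadditive D]
  [Linear k D]

/-- The morphisms of the `k`-linearization are finite linear combinations of morphisms. -/
theorem hom_induction {X Y : C}
    {P : ((Free.embedding k C).obj X ⟶ (Free.embedding k C).obj Y) → Prop}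
    (f : (Free.embedding k C).obj X ⟶ (Free.embedding k C).obj Y) (h0 : P 0)
    (hadd : ∀ f g, P f → P g → P (f + g))
    (hs : ∀ (r : k) (g : X ⟶ Y), P (r • (Free.embedding k C).map g)) : P f := by
  refine Finsupp.induction_linear (motive := fun f : (X ⟶ Y) →₀ k => P f) f h0 hadd ?_
  intro g r
  have h := hs r g
  have e : r • (Free.embedding k C).map g = (Finsupp.single g r : (X ⟶ Y) →₀ k) :=
    Finsupp.smul_single_one g r
  rw [e] at h
  exact h

/-- The linear extension of a functor, on morphisms. -/
noncomputable def mapHom (F : C ⥤ D) (X Y : C) :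
    ((Free.embedding k C).obj X ⟶ (Free.embedding k C).obj Y) →ₗ[k] (F.obj X ⟶ F.obj Y) :=
  Finsupp.linearCombination k (fun f : X ⟶ Y => F.map f)

theorem mapHom_embedding (F : C ⥤ D) {X Y : C} (f : X ⟶ Y) :
    mapHom F X Y ((Free.embedding k C).map f) = F.map f := by
  change Finsupp.linearCombination k (fun f : X ⟶ Y => F.map f) (Finsupp.single f 1) = _
  simp

theorem mapHom_comp (F : C ⥤ D) {X Y Z : C}
    (f : (Free.embedding k C).obj X ⟶ (Free.embedding k C).obj Y)
    (g : (Free.embedding k C).obj Y ⟶ (Free.embedding k C).obj Z) :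
    mapHom F X Z (f ≫ g) = mapHom F X Y f ≫ mapHom F Y Z g := by
  induction f using hom_induction with
  | h0 => simp only [Limits.zero_comp, map_zero]
  | hadd f f' h h' => simp only [Preadditive.add_comp, map_add, h, h']
  | hs r f =>
    induction g using hom_induction with
    | h0 => simp only [Limits.comp_zero, map_zero]
    | hadd g g' h h' => simp only [Preadditive.comp_add, map_add, h, h']
    | hs s g =>
      rw [Linear.smul_comp, Linear.comp_smul, ← Functor.map_comp]
      simp only [map_smul, mapHom_embedding, Functor.map_comp, Linear.smul_comp, Linear.comp_smul]
      rw [← Functor.map_comp, mapHom_embedding, Functor.map_comp, smul_comm]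

/-- The `k`-linear functor on the `k`-linearization of `C` that extends a functor on `C`. -/
noncomputable def lift (F : C ⥤ D) : Free k C ⥤ D where
  obj X := F.obj X
  map {X Y} f := mapHom F X Y f
  map_id X := by
    have := mapHom_embedding (k := k) F (𝟙 (show C from X))
    rw [F.map_id] at this
    exact this
  map_comp f g := mapHom_comp F f g

theorem lift_map_embedding (F : C ⥤ D) {X Y : C} (f : X ⟶ Y) :
    (lift F).map ((Free.embedding k C).map f) = F.map f :=
  mapHom_embedding F f

instance lift_additive (F : C ⥤ D) : (lift (k := k) F).Additive where
  map_add {X Y f g} := map_add (mapHom (k := k) F X Y) f g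

instance lift_linear (F : C ⥤ D) : (lift (k := k) F).Linear k where
  map_smul {X Y} f r := map_smul (mapHom (k := k) F X Y) r f

/-- Naturality of a family of morphisms between `k`-linear functors on the `k`-linearization of
`C` can be tested on the morphisms of `C`. -/
theorem natural_of_embedding {F G : Free k C ⥤ D} [F.Additive] [F.Linear k] [G.Additive]
    [G.Linear k] (α : ∀ X : C,
      F.obj ((Free.embedding k C).obj X) ⟶ G.obj ((Free.embedding k C).obj X))
    (h : ∀ {X Y : C} (g : X ⟶ Y), F.map ((Free.embedding k C).map g) ≫ α Y =
      α X ≫ G.map ((Free.embedding k C).map g)) {X Y : C}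
    (f : (Free.embedding k C).obj X ⟶ (Free.embedding k C).obj Y) :
    F.map f ≫ α Y = α X ≫ G.map f := by
  induction f using hom_induction with
  | h0 => simp only [Functor.map_zero, Limits.zero_comp, Limits.comp_zero]
  | hadd f f' h h' => simp only [Functor.map_add, Preadditive.add_comp, Preadditive.comp_add, h, h']
  | hs r f => simp only [Functor.map_smul, Linear.smul_comp, Linear.comp_smul, h]

end general

end KLin

/-- A correspondence functor over `k`: a `k`-linear functor from `k𝒞`, the `k`-linearization of
the category of finite sets and correspondences, to the category of `k`-modules. -/
structure CorrFunctor (k : Type u) [CommRing k] where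
  toFunctor : Free k FinCorr.{v} ⥤ ModuleCat.{w} k
  [additive : toFunctor.Additive]
  [linear : toFunctor.Linear k]

namespace CorrFunctor

attribute [instance] CorrFunctor.additive CorrFunctor.linear

variable {k : Type u} [CommRing k]

/-- A morphism of correspondence functors is a natural transformation; the morphisms form a
`k`-module with pointwise operations. -/
abbrev Hom (M N : CorrFunctor.{u, v, w} k) : Type (max (v + 1) w) :=
  M.toFunctor ⟶ N.toFunctor

/-- The value `M(X)` at a finite set `X`. -/
noncomputable abbrev val (M : CorrFunctor.{u, v, w} k) (X : FinCorr.{v}) : ModuleCat.{w} k :=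
  M.toFunctor.obj ((Free.embedding k FinCorr.{v}).obj X)

/-- `M` is generated by the subset `A` of `M(E)`: for every finite set `X`, the `k`-module `M(X)`
is spanned by the elements `f a` with `f ∈ k𝒞(X, E)` and `a ∈ A`. -/
def GeneratedBy (M : CorrFunctor.{u, v, w} k) (E : FinCorr.{v}) (A : Set (M.val E)) : Prop :=
  ∀ X : FinCorr.{v}, Submodule.span k
    {y : M.val X | ∃ f : (Free.embedding k FinCorr.{v}).obj E ⟶ (Free.embedding k FinCorr.{v}).obj X,
      ∃ a ∈ A, y = M.toFunctor.map f a} = ⊤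

/-- `M` is generated by `M(E)`. -/
def GeneratedAt (M : CorrFunctor.{u, v, w} k) (E : FinCorr.{v}) : Prop :=
  M.GeneratedBy E Set.univ

/-- `M` has bounded type. -/
def BoundedType (M : CorrFunctor.{u, v, w} k) : Prop :=
  ∃ E : FinCorr.{v}, M.GeneratedAt E

/-- `M` is finitely generated. -/
def FinitelyGenerated (M : CorrFunctor.{u, v, w} k) : Prop :=
  ∃ (E : FinCorr.{v}) (A : Set (M.val E)), A.Finite ∧ M.GeneratedBy E A

/-- The `k`-linear endofunctor `t_E` of `k𝒞`: `X ↦ X ⊔ E` and `U ↦ U ⊔ Δ_E`. -/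
noncomputable def t (k : Type u) [CommRing k] (E : FinCorr.{v}) :
    Free k FinCorr.{v} ⥤ Free k FinCorr.{v} :=
  KLin.lift (FinCorr.sumRight E ⋙ Free.embedding k FinCorr.{v})

instance (E : FinCorr.{v}) : (t k E).Additive := by unfold t; infer_instance

instance (E : FinCorr.{v}) : (t k E).Linear k := by unfold t; infer_instance

/-- The natural transformation `Id ⊔ V : t_E ⟶ t_F` for a correspondence `V` from `E` to `F`. -/
noncomputable def tMap (k : Type u) [CommRing k] {E F : FinCorr.{v}} (V : E ⟶ F) :
    t k E ⟶ t k F where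
  app X := (Free.embedding k FinCorr.{v}).map (FinCorr.sumMap (𝟙 (show FinCorr.{v} from X)) V)
  naturality X Y f := by
    refine KLin.natural_of_embedding (F := t k E) (G := t k F)
      (fun X => (Free.embedding k FinCorr.{v}).map (FinCorr.sumMap (𝟙 X) V)) ?_ f
    intro X Y g
    have hE : (t k E).map ((Free.embedding k FinCorr.{v}).map g) =
        (Free.embedding k FinCorr.{v}).map (FinCorr.sumMap g (𝟙 E)) :=
      KLin.lift_map_embedding (FinCorr.sumRight E ⋙ Free.embedding k FinCorr.{v}) g
    have hF : (t k F).map ((Free.embedding k FinCorr.{v}).map g) =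
        (Free.embedding k FinCorr.{v}).map (FinCorr.sumMap g (𝟙 F)) :=
      KLin.lift_map_embedding (FinCorr.sumRight F ⋙ Free.embedding k FinCorr.{v}) g
    rw [hE, hF]
    exact ((Free.embedding k FinCorr.{v}).map_comp _ _).symm.trans
      ((congrArg (Free.embedding k FinCorr.{v}).map (FinCorr.sumMap_swap g V)).trans
        ((Free.embedding k FinCorr.{v}).map_comp _ _))

/-- The shift `M_E = M ∘ t_E`, so that `M_E(X) = M(X ⊔ E)`. -/
noncomputable def shift (M : CorrFunctor.{u, v, w} k) (E : FinCorr.{v}) :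
    CorrFunctor.{u, v, w} k where
  toFunctor := t k E ⋙ M.toFunctor

/-- The morphism `M_V : M_E ⟶ M_F` for a correspondence `V` from `E` to `F`. -/
noncomputable def shiftMap (M : CorrFunctor.{u, v, w} k) {E F : FinCorr.{v}} (V : E ⟶ F) :
    Hom (M.shift E) (M.shift F) :=
  Functor.whiskerRight (tMap k V) M.toFunctor

theorem shiftMap_id (M : CorrFunctor.{u, v, w} k) (E : FinCorr.{v}) :
    M.shiftMap (𝟙 E) = 𝟙 _ := by
  apply NatTrans.ext
  funext X
  have h := FinCorr.sumMap_id (show FinCorr.{v} from X) E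
  have h' := congrArg (Free.embedding k FinCorr.{v}).map h
  rw [CategoryTheory.Functor.map_id] at h'
  exact (congrArg M.toFunctor.map h').trans (M.toFunctor.map_id _)

theorem shiftMap_comp (M : CorrFunctor.{u, v, w} k) {E F G : FinCorr.{v}} (V : E ⟶ F)
    (W : F ⟶ G) : M.shiftMap (V ≫ W) = M.shiftMap V ≫ M.shiftMap W := by
  apply NatTrans.ext
  funext X
  change M.toFunctor.map ((Free.embedding k FinCorr.{v}).map
      (FinCorr.sumMap (𝟙 (show FinCorr.{v} from X)) (V ≫ W))) =
    M.toFunctor.map ((Free.embedding k FinCorr.{v}).map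
      (FinCorr.sumMap (𝟙 (show FinCorr.{v} from X)) V)) ≫
    M.toFunctor.map ((Free.embedding k FinCorr.{v}).map
      (FinCorr.sumMap (𝟙 (show FinCorr.{v} from X)) W))
  rw [← Functor.map_comp, ← Functor.map_comp, ← FinCorr.sumMap_comp, Category.comp_id]

/-- The internal hom on correspondences: `E ↦ Hom(M, N_E)`, and `V` acts by composition
with `N_V`. -/
noncomputable def ihomAux (M N : CorrFunctor.{u, v, w} k) :
    FinCorr.{v} ⥤ ModuleCat.{max (v + 1) w} k where
  obj E := ModuleCat.of k (Hom M (N.shift E))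
  map V := ModuleCat.ofHom (Linear.rightComp k M.toFunctor (N.shiftMap V))
  map_id E := by
    refine ModuleCat.hom_ext (LinearMap.ext fun f => ?_)
    change f ≫ N.shiftMap (𝟙 E) = f
    rw [shiftMap_id]
    exact Category.comp_id f
  map_comp V W := by
    refine ModuleCat.hom_ext (LinearMap.ext fun f => ?_)
    change f ≫ N.shiftMap (V ≫ W) = (f ≫ N.shiftMap V) ≫ N.shiftMap W
    rw [shiftMap_comp, Category.assoc]

/-- The internal hom `ℋ(M, N)`: the `k`-linear extension of `E ↦ Hom(M, N_E)`. -/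
noncomputable def ihom (M N : CorrFunctor.{u, v, w} k) :
    CorrFunctor.{u, v, max (v + 1) w} k where
  toFunctor := KLin.lift (ihomAux M N)

end CorrFunctor

/-! For shifts, a correspondence from `E` to `X ⊔ F` factors as a correspondence `E ⟶ E ⊔ F`
followed by one of the form `W ⊔ Δ_F`. So generators of `M` in `M(E)` yield generators of `M_F` in
`M_F(E) = M(E ⊔ F)`, one for each correspondence `E ⟶ E ⊔ F` and each generator; this is a finite
set if the generators are finite in number (`generated_sumRight`).

For the internal hom, a morphism `M ⟶ N_X` is determined by its values on a finite generating set `A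
⊆ M(F)`. This embeds `ℋ(M, N)` in a product of copies of `N_F` indexed by `A`, which has bounded
type, or is finitely generated, by the case of shifts. What remains is a noetherian property
(`Sub.le_generated`): over a noetherian ring, every subfunctor `S` of a functor `G` generated at `E`
is generated at a set `D` with `2 ^ |E|` elements.

This property comes from comparing growth rates. If `F` is a smallest set with `H(F) ≠ 0`, then `H(F
⊔ X)` has length at least `|F| ^ |X|` (`card_pow_le_length`). But `G(X)` is spanned by a constant
multiple of `2 ^ (|E| |X|) = |D| ^ |X|` elements. A subquotient of `G` of finite length that
vanishes at `D` can only have `|F| > |D|`, which grows too fast, so it is zero. If `S` were not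
generated at `D`, Artin-Rees and reduction modulo a power of a maximal ideal would produce a nonzero
subquotient of this kind. -/

namespace FinCorr

/-! ### Correspondences as relations -/

/-- Membership of a pair in a correspondence. -/
def Rel {X Y : FinCorr.{v}} (U : X ⟶ Y) (y : Y.carrier) (x : X.carrier) : Prop :=
  (y, x) ∈ (show Set (Y.carrier × X.carrier) from U)

/-- The correspondence defined by a relation. -/
def ofRel {X Y : FinCorr.{v}} (r : Y.carrier → X.carrier → Prop) : X ⟶ Y :=
  show Set (Y.carrier × X.carrier) from {p | r p.1 p.2}

@[simp] theorem rel_ofRel {X Y : FinCorr.{v}} (r : Y.carrier → X.carrier → Prop)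
    (y : Y.carrier) (x : X.carrier) : Rel (ofRel r) y x ↔ r y x := Iff.rfl

@[simp] theorem rel_id {X : FinCorr.{v}} (y x : X.carrier) : Rel (𝟙 X) y x ↔ y = x := Iff.rfl

@[simp] theorem rel_comp {X Y Z : FinCorr.{v}} (U : X ⟶ Y) (V : Y ⟶ Z) (z : Z.carrier)
    (x : X.carrier) : Rel (U ≫ V) z x ↔ ∃ y, Rel V z y ∧ Rel U y x := Iff.rfl

theorem hom_ext_rel {X Y : FinCorr.{v}} {U V : X ⟶ Y} (h : ∀ y x, Rel U y x ↔ Rel V y x) :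
    U = V :=
  Set.ext fun p => h p.1 p.2

instance finite_hom (X Y : FinCorr.{v}) : Finite (X ⟶ Y) :=
  inferInstanceAs (Finite (Set (Y.carrier × X.carrier)))

/-- A nonempty property of correspondences is satisfied by one that is maximal for inclusion. -/
theorem exists_maximal_hom {X Y : FinCorr.{v}} (P : (X ⟶ Y) → Prop) (h : ∃ U, P U) :
    ∃ U, P U ∧ ∀ V, P V → (∀ y x, Rel U y x → Rel V y x) → V = U := by
  obtain ⟨U, hU⟩ := (Set.toFinite (α := Set (Y.carrier × X.carrier)) {U | P U}).exists_maximal h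
  refine ⟨U, hU.prop, fun V hV hle => ?_⟩
  have h1 : (show Set (Y.carrier × X.carrier) from U) ≤ V := fun p hp => hle p.1 p.2 hp
  exact le_antisymm (α := Set (Y.carrier × X.carrier)) (hU.le_of_ge hV h1) h1

/-- A preorder that is not antisymmetric factors through a smaller set. -/
theorem factors_of_not_antisymm {F : FinCorr.{v}} (R : F ⟶ F) (hr : ∀ a, Rel R a a)
    (ht : ∀ a b c, Rel R a b → Rel R b c → Rel R a c) {a b : F.carrier} (hab : Rel R a b)
    (hba : Rel R b a) (hne : a ≠ b) :
    ∃ (Y : FinCorr.{v}) (U : F ⟶ Y) (V : Y ⟶ F),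
      Nat.card Y.carrier < Nat.card F.carrier ∧ U ≫ V = R := by
  refine ⟨⟨{c : F.carrier // c ≠ b}⟩, ofRel fun y x => Rel R y.1 x, ofRel fun x y => Rel R x y.1,
    ?_, ?_⟩
  · exact Finite.card_subtype_lt (p := fun c => c ≠ b) (x := b) (by simp)
  · refine hom_ext_rel fun x z => ?_
    simp only [rel_comp, rel_ofRel]
    refine ⟨fun ⟨y, h1, h2⟩ => ht _ _ _ h1 h2, fun h => ?_⟩
    -- The deleted point `b` is replaced by the equivalent point `a`.
    by_cases hx : x = b
    · subst hx
      exact ⟨⟨a, hne⟩, hba, ht _ _ _ hab h⟩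
    · exact ⟨⟨x, hx⟩, hr x, h⟩

end FinCorr

/-! ### Exponential lower bound for growth -/

namespace CorrAction

open FinCorr

variable {k : Type u} [CommRing k]

/-- The linear action of a correspondence. -/
def act (G : FinCorr.{v} ⥤ ModuleCat.{w} k) {X Y : FinCorr.{v}} (U : X ⟶ Y) :
    G.obj X →ₗ[k] G.obj Y :=
  (G.map U).hom

theorem act_id (G : FinCorr.{v} ⥤ ModuleCat.{w} k) {X : FinCorr.{v}} (x : G.obj X) :
    act G (𝟙 X) x = x := by
  simp [act]

theorem act_comp (G : FinCorr.{v} ⥤ ModuleCat.{w} k) {X Y Z : FinCorr.{v}} (U : X ⟶ Y)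
    (V : Y ⟶ Z) (x : G.obj X) : act G (U ≫ V) x = act G V (act G U x) := by
  simp [act]

/-- If `F` is minimal with `H(F) ≠ 0`, there are an order relation `R` on `F` and a nonzero
vector fixed by `R` and killed by all `Q ⊋ R` with `R Q = Q`. -/
theorem exists_order_vector (H : FinCorr.{v} ⥤ ModuleCat.{w} k) (F : FinCorr.{v})
    [Nontrivial (H.obj F)]
    (hmin : ∀ Y : FinCorr.{v}, Nat.card Y.carrier < Nat.card F.carrier →
      Subsingleton (H.obj Y)) :
    ∃ (R : F ⟶ F) (v : H.obj F), (∀ a, Rel R a a) ∧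
      (∀ a b c, Rel R a b → Rel R b c → Rel R a c) ∧
      (∀ a b, Rel R a b → Rel R b a → a = b) ∧ v ≠ 0 ∧ act H R v = v ∧
      ∀ Q : F ⟶ F, (∀ a b, Rel R a b → Rel Q a b) → Q ≫ R = Q → Q ≠ R → act H Q v = 0 := by
  -- Two successive maximal choices: a preorder `R` with nonzero action, then `W ⊇ R` stable under
  -- `R` with nonzero action. The vector is any nonzero `W w`.
  obtain ⟨R, ⟨hr, ht, hR0⟩, hRmax⟩ := exists_maximal_hom (X := F) (Y := F)
    (fun R => (∀ a, Rel R a a) ∧ (∀ a b c, Rel R a b → Rel R b c → Rel R a c) ∧ act H R ≠ 0) (by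
      refine ⟨𝟙 F, fun a => rfl, fun a b c h h' => h.trans h', fun h => ?_⟩
      obtain ⟨x, hx⟩ := exists_ne (0 : H.obj F)
      exact hx (by rw [← act_id H x, h, LinearMap.zero_apply]))
  have hRR : R ≫ R = R := hom_ext_rel fun a b =>
    ⟨fun ⟨c, h1, h2⟩ => ht _ _ _ h1 h2, fun h => ⟨a, hr a, h⟩⟩
  obtain ⟨W, ⟨hRW, hW, hW0⟩, hWmax⟩ := exists_maximal_hom (X := F) (Y := F)
    (fun W => (∀ a b, Rel R a b → Rel W a b) ∧ W ≫ R = W ∧ act H W ≠ 0)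
    ⟨R, fun _ _ h => h, hRR, hR0⟩
  obtain ⟨w, hw⟩ : ∃ w, act H W w ≠ 0 := by
    by_contra! h
    exact hW0 (LinearMap.ext h)
  refine ⟨R, act H W w, hr, ht, ?_, hw, ?_, ?_⟩
  -- Otherwise `R` factors through a smaller set, where `H` vanishes, and so acts by zero.
  · intro a b hab hba
    by_contra hne
    obtain ⟨Y, U, V, hcard, hUV⟩ := factors_of_not_antisymm R hr ht hab hba hne
    have := hmin Y hcard
    refine hR0 (LinearMap.ext fun x => ?_)
    rw [← hUV, act_comp, Subsingleton.elim (act H U x) 0, map_zero, LinearMap.zero_apply]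
  · rw [← act_comp, hW]
  · intro Q hRQ hQ hne
    rw [← act_comp]
    by_contra hQw
    have hQr : ∀ a, Rel Q a a := fun a => hRQ a a (hr a)
    -- If `Q` does not kill `W w`, then `W ≫ Q` is an admissible choice containing `W`.
    have hWQ : W ≫ Q = W := by
      refine hWmax _ ⟨?_, ?_, ?_⟩ fun a b h => ⟨a, hQr a, h⟩
      · exact fun a b h => ⟨a, hQr a, hRW _ _ h⟩
      · rw [Category.assoc, hQ]
      · exact fun h => hQw (by rw [h, LinearMap.zero_apply])
    -- `Q` need not be transitive, so maximality of `R` is applied to its closure `T`, a preorder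
    -- containing `R` that `W` still absorbs.
    let T : F ⟶ F := ofRel (Relation.ReflTransGen fun a b => Rel Q a b)
    have hWT : W ≫ T = W := by
      have key : ∀ a b c, Relation.ReflTransGen (fun a b => Rel Q a b) a c → Rel W c b →
          Rel W a b := by
        intro a b c h1 h2
        induction h1 using Relation.ReflTransGen.head_induction_on with
        | refl => exact h2
        | head h _ ih =>
          rw [← hWQ]
          exact ⟨_, h, ih⟩
      exact hom_ext_rel fun a b => ⟨fun ⟨c, h1, h2⟩ => key a b c h1 h2, fun h => ⟨a, .refl, h⟩⟩
    have hT0 : act H T = 0 := by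
      by_contra hT0
      have hTR := hRmax T ⟨fun a => .refl, fun a b c h h' => h.trans h', hT0⟩
        fun a b h => .single (hRQ _ _ h)
      refine hne (hom_ext_rel fun a b => ⟨fun h => ?_, hRQ a b⟩)
      rw [← hTR]
      exact .single h
    exact hw (by rw [← hWT, act_comp, hT0, LinearMap.zero_apply])

/-- Exponential growth of a functor whose smallest set of nonvanishing is `F`. -/
theorem card_pow_le_length (H : FinCorr.{v} ⥤ ModuleCat.{w} k) (F X : FinCorr.{v})
    [Nontrivial (H.obj F)]
    (hmin : ∀ Y : FinCorr.{v}, Nat.card Y.carrier < Nat.card F.carrier →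
      Subsingleton (H.obj Y)) :
    ((Nat.card F.carrier ^ Nat.card X.carrier : ℕ) : ℕ∞) ≤
      Module.length k (H.obj (FinCorr.sum F X)) := by
  classical
  obtain ⟨R, v, hr, ht, ha, hv, hRv, hQv⟩ := exists_order_vector H F hmin
  let _ : PartialOrder F.carrier :=
    { le := fun a b => Rel R a b
      le_refl := hr
      le_trans := ht
      le_antisymm := ha }
  -- Keeping the identity on the summand `F` makes every composite `Γ φ ≫ V ψ` contain `R`. It
  -- equals `R` exactly when `ψ ≤ φ`, and otherwise it kills `v`.
  let ext : (X.carrier → F.carrier) → F.carrier ⊕ X.carrier → F.carrier :=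
    fun φ => Sum.elim id φ
  let Γ : (X.carrier → F.carrier) → (F ⟶ FinCorr.sum F X) := fun φ =>
    ofRel (Y := FinCorr.sum F X) fun x b => b = ext φ x
  let V : (X.carrier → F.carrier) → (FinCorr.sum F X ⟶ F) := fun ψ =>
    ofRel (X := FinCorr.sum F X) fun a x => a ≤ ext ψ x
  have hle : ∀ φ ψ, ψ ≤ φ → act H (V ψ) (act H (Γ φ) v) = v := by
    intro φ ψ h
    suffices hR : Γ φ ≫ V ψ = R by rw [← act_comp, hR, hRv]
    refine hom_ext_rel fun a b => ⟨?_, fun h => ⟨Sum.inl b, h, rfl⟩⟩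
    rintro ⟨x | x, h1, h2⟩
    · exact le_trans (α := F.carrier) h1 (le_of_eq h2.symm)
    · exact le_trans (α := F.carrier) h1 (le_trans (h x) (le_of_eq h2.symm))
  have hnle : ∀ φ ψ, ¬ ψ ≤ φ → act H (V ψ) (act H (Γ φ) v) = 0 := by
    intro φ ψ h
    rw [← act_comp]
    refine hQv _ (fun a b h => ⟨Sum.inl b, h, rfl⟩) ?_ ?_
    · refine hom_ext_rel fun a b => ⟨?_, fun h => ⟨a, hr a, h⟩⟩
      rintro ⟨c, h1, x, h2, h3⟩
      exact ⟨x, le_trans (α := F.carrier) h1 h2, h3⟩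
    · intro he
      refine h fun x => ?_
      change Rel R (ψ x) (φ x)
      rw [← he]
      exact ⟨Sum.inr x, le_refl (ψ x), rfl⟩
  let Θ : H.obj (FinCorr.sum F X) →ₗ[k] ((X.carrier → F.carrier) → H.obj F) :=
    LinearMap.pi fun ψ => act H (V ψ)
  -- The vector `v` may have torsion; only `L ≠ 0`, hence length at least 1, is needed.
  let L : Submodule k (H.obj F) := Submodule.span k {v}
  have hsingle : ∀ φ, (Pi.single φ v : (X.carrier → F.carrier) → H.obj F) ∈ LinearMap.range Θ := by
    intro φ
    induction φ using WellFoundedLT.induction with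
    | ind φ ih =>
      have := Fintype.ofFinite (X.carrier → F.carrier)
      -- The matrix of pairings is unitriangular for the pointwise order, so it is inverted by
      -- induction on `φ`.
      have : (Pi.single φ v : (X.carrier → F.carrier) → H.obj F) =
          Θ (act H (Γ φ) v) - ∑ ψ ∈ Finset.univ.filter (· < φ), Pi.single ψ v := by
        funext χ
        rw [Pi.sub_apply, Finset.sum_apply]
        change _ = act H (V χ) (act H (Γ φ) v) - _
        simp only [Pi.single_apply, Finset.sum_ite_eq, Finset.mem_filter, Finset.mem_univ,
          true_and]
        by_cases h1 : χ ≤ φ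
        · rw [hle _ _ h1]
          rcases h1.eq_or_lt with rfl | h2
          · simp
          · simp [h2, h2.ne]
        · rw [hnle _ _ h1]
          have h2 : ¬ χ < φ := fun h => h1 h.le
          have h3 : χ ≠ φ := fun h => h1 h.le
          simp [h2, h3]
      rw [this]
      refine Submodule.sub_mem _ ⟨_, rfl⟩ (Submodule.sum_mem _ fun ψ hψ => ih ψ ?_)
      simpa using hψ
  have hrange : ∀ f : (X.carrier → F.carrier) → L, (fun φ => (f φ : H.obj F)) ∈
      LinearMap.range Θ := by
    intro f
    have := Fintype.ofFinite (X.carrier → F.carrier)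
    rw [← Finset.univ_sum_single (fun φ => (f φ : H.obj F))]
    refine Submodule.sum_mem _ fun φ _ => ?_
    obtain ⟨c, hc⟩ := Submodule.mem_span_singleton.mp (f φ).2
    rw [← hc, Pi.single_smul]
    exact Submodule.smul_mem _ _ (hsingle φ)
  let ι : ((X.carrier → F.carrier) → L) →ₗ[k] LinearMap.range Θ :=
    LinearMap.codRestrict _ (LinearMap.compLeft L.subtype _) hrange
  have hι : Function.Injective ι := by
    intro f g h
    funext φ
    exact Subtype.ext (congrFun (congrArg Subtype.val h) φ)
  have : Nontrivial L := ⟨⟨⟨v, Submodule.mem_span_singleton_self v⟩, 0,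
    fun h => hv (congrArg Subtype.val h)⟩⟩
  have hL : 1 ≤ Module.length k L := Order.one_le_iff_pos.mpr Module.length_pos
  calc ((Nat.card F.carrier ^ Nat.card X.carrier : ℕ) : ℕ∞)
      = ENat.card (X.carrier → F.carrier) := by
        rw [← Nat.card_fun, ENat.card_eq_coe_natCard]
    _ ≤ ENat.card (X.carrier → F.carrier) * Module.length k L := le_mul_of_one_le_right' hL
    _ = Module.length k ((X.carrier → F.carrier) → L) := (Module.length_pi ..).symm
    _ ≤ Module.length k (LinearMap.range Θ) := Module.length_le_of_injective ι hι
    _ ≤ Module.length k (H.obj (FinCorr.sum F X)) :=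
        Module.length_le_of_surjective Θ.rangeRestrict Θ.surjective_rangeRestrict

end CorrAction

/-! ### Subfunctors, quotients and lengths -/

namespace CorrAction

open FinCorr

variable {k : Type u} [CommRing k]

/-- A subfunctor of a functor from correspondences to modules. -/
structure Sub (G : FinCorr.{v} ⥤ ModuleCat.{w} k) where
  obj : ∀ X : FinCorr.{v}, Submodule k (G.obj X)
  act_mem : ∀ {X Y : FinCorr.{v}} (U : X ⟶ Y) {x : G.obj X}, x ∈ obj X → act G U x ∈ obj Y

/-- The subfunctor generated by a set of elements of `G(E)`. -/
def generated (G : FinCorr.{v} ⥤ ModuleCat.{w} k) (E : FinCorr.{v}) (A : Set (G.obj E)) :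
    Sub G where
  obj X := Submodule.span k {y | ∃ U : E ⟶ X, ∃ a ∈ A, y = act G U a}
  act_mem {X Y} V x hx := by
    induction hx using Submodule.span_induction with
    | mem x hx =>
      obtain ⟨U, a, ha, rfl⟩ := hx
      exact Submodule.subset_span ⟨U ≫ V, a, ha, (act_comp G U V a).symm⟩
    | zero => rw [map_zero]; exact Submodule.zero_mem _
    | add x y _ _ hx hy => rw [map_add]; exact Submodule.add_mem _ hx hy
    | smul r x _ hx => rw [map_smul]; exact Submodule.smul_mem _ r hx

theorem act_mem_generated (G : FinCorr.{v} ⥤ ModuleCat.{w} k) {E X : FinCorr.{v}}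
    {A : Set (G.obj E)} (U : E ⟶ X) {a : G.obj E} (ha : a ∈ A) :
    act G U a ∈ (generated G E A).obj X :=
  Submodule.subset_span ⟨U, a, ha, rfl⟩

theorem mem_generated (G : FinCorr.{v} ⥤ ModuleCat.{w} k) {E : FinCorr.{v}}
    {A : Set (G.obj E)} {a : G.obj E} (ha : a ∈ A) : a ∈ (generated G E A).obj E := by
  simpa only [act_id] using act_mem_generated G (𝟙 E) ha

theorem generated_le {G : FinCorr.{v} ⥤ ModuleCat.{w} k} {E : FinCorr.{v}} {A : Set (G.obj E)}
    (S : Sub G) (h : A ⊆ S.obj E) (X : FinCorr.{v}) : (generated G E A).obj X ≤ S.obj X := by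
  refine Submodule.span_le.mpr ?_
  rintro _ ⟨U, a, ha, rfl⟩
  exact S.act_mem U (h ha)

/-- A finitely generated functor has finitely generated values. -/
theorem finite_obj_of_generated {G : FinCorr.{v} ⥤ ModuleCat.{w} k} {E : FinCorr.{v}}
    {A : Set (G.obj E)} (hA : A.Finite) (X : FinCorr.{v}) (hG : (generated G E A).obj X = ⊤) :
    Module.Finite k (G.obj X) := by
  have : Finite A := hA
  refine ⟨Submodule.fg_def.mpr ⟨_, ?_, hG⟩⟩
  refine (Set.finite_range fun p : (E ⟶ X) × A => act G p.1 p.2).subset ?_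
  rintro _ ⟨U, a, ha, rfl⟩
  exact ⟨(U, ⟨a, ha⟩), rfl⟩

/-- A subfunctor as a functor. -/
def Sub.toFunctor {G : FinCorr.{v} ⥤ ModuleCat.{w} k} (S : Sub G) :
    FinCorr.{v} ⥤ ModuleCat.{w} k where
  obj X := ModuleCat.of k (S.obj X)
  map U := ModuleCat.ofHom ((act G U).restrict fun _ hx => S.act_mem U hx)
  map_id X := by
    refine ModuleCat.hom_ext (LinearMap.ext fun x => Subtype.ext ?_)
    exact act_id G x.1
  map_comp U V := by
    refine ModuleCat.hom_ext (LinearMap.ext fun x => Subtype.ext ?_)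
    exact act_comp G U V x.1

/-- The quotient `T / (T ∩ B)` of two subfunctors. -/
def Sub.quotient {G : FinCorr.{v} ⥤ ModuleCat.{w} k} (T B : Sub G) :
    FinCorr.{v} ⥤ ModuleCat.{w} k where
  obj X := ModuleCat.of k (T.obj X ⧸ (B.obj X).submoduleOf (T.obj X))
  map {X Y} U := ModuleCat.ofHom (Submodule.mapQ ((B.obj X).submoduleOf (T.obj X))
    ((B.obj Y).submoduleOf (T.obj Y)) (act T.toFunctor U) fun _ hx => B.act_mem U hx)
  map_id X := by
    refine ModuleCat.hom_ext (LinearMap.ext fun x => ?_)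
    obtain ⟨x, rfl⟩ := Submodule.mkQ_surjective _ x
    exact congrArg (Submodule.mkQ _) (act_id T.toFunctor x)
  map_comp U V := by
    refine ModuleCat.hom_ext (LinearMap.ext fun x => ?_)
    obtain ⟨x, rfl⟩ := Submodule.mkQ_surjective _ x
    exact congrArg (Submodule.mkQ _) (act_comp T.toFunctor U V x)

theorem Sub.subsingleton_quotient_iff {G : FinCorr.{v} ⥤ ModuleCat.{w} k} (T B : Sub G)
    (X : FinCorr.{v}) : Subsingleton ((T.quotient B).obj X) ↔ T.obj X ≤ B.obj X := by
  change Subsingleton (T.obj X ⧸ (B.obj X).submoduleOf (T.obj X)) ↔ _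
  rw [Submodule.Quotient.subsingleton_iff]
  exact Submodule.comap_subtype_eq_top

theorem Sub.length_quotient_le {G : FinCorr.{v} ⥤ ModuleCat.{w} k} (T B : Sub G)
    (X : FinCorr.{v}) :
    Module.length k ((T.quotient B).obj X) ≤ Module.length k (G.obj X ⧸ B.obj X) := by
  let f : (T.obj X ⧸ (B.obj X).submoduleOf (T.obj X)) →ₗ[k] (G.obj X ⧸ B.obj X) :=
    Submodule.mapQ _ _ (T.obj X).subtype le_rfl
  have hf : LinearMap.ker f = ⊥ := by
    refine (Submodule.ker_mapQ _ _ _ le_rfl).trans ?_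
    exact Submodule.mkQ_map_self _
  exact Module.length_le_of_injective f (LinearMap.ker_eq_bot.mp hf)

/-- Vanishing at a set passes to smaller sets. -/
theorem subsingleton_of_card_le (H : FinCorr.{v} ⥤ ModuleCat.{w} k) {D Y : FinCorr.{v}}
    (h : Nat.card Y.carrier ≤ Nat.card D.carrier) (hD : Subsingleton (H.obj D)) :
    Subsingleton (H.obj Y) := by
  obtain ⟨i⟩ : Nonempty (Y.carrier ↪ D.carrier) := by
    have := Fintype.ofFinite Y.carrier
    have := Fintype.ofFinite D.carrier
    rw [Function.Embedding.nonempty_iff_card_le, ← Nat.card_eq_fintype_card,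
      ← Nat.card_eq_fintype_card]
    exact h
  -- The injection makes `Y` a retract of `D` in the category of correspondences.
  let U : Y ⟶ D := ofRel fun d y => d = i y
  let V : D ⟶ Y := ofRel fun y d => d = i y
  have hUV : U ≫ V = 𝟙 Y := hom_ext_rel fun y y' =>
    ⟨fun ⟨_, h1, h2⟩ => i.injective (h1.symm.trans h2), fun h => ⟨i y, rfl, congrArg i h⟩⟩
  refine ⟨fun x y => ?_⟩
  rw [← act_id H x, ← act_id H y, ← hUV, act_comp, act_comp, Subsingleton.elim (act H U x)]

/-- Since `f / d > 1`, some power `(f / d) ^ n` exceeds the constant `C * d ^ f`. The exponent `f +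
n` is the cardinality of the set at which the lower growth bound is evaluated. -/
theorem exists_lt_pow {d f : ℕ} (hd : 0 < d) (hdf : d < f) (C : ℕ) :
    ∃ n : ℕ, C * d ^ (f + n) < f ^ n := by
  have h1 : (1 : ℝ) < f / d := by
    rw [one_lt_div (by exact_mod_cast hd)]
    exact_mod_cast hdf
  obtain ⟨n, hn⟩ := pow_unbounded_of_one_lt ((C * d ^ f : ℕ) : ℝ) h1
  refine ⟨n, ?_⟩
  rw [div_pow, lt_div_iff₀ (by positivity)] at hn
  rw [pow_add, ← mul_assoc]
  exact_mod_cast hn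

/-- A functor of growth at most `c ^ |X|` that vanishes at a set of cardinality `c` is zero. -/
theorem subsingleton_of_length_le (H : FinCorr.{v} ⥤ ModuleCat.{w} k) (D : FinCorr.{v})
    (hD0 : 0 < Nat.card D.carrier) (C : ℕ)
    (hlen : ∀ X : FinCorr.{v}, Module.length k (H.obj X) ≤
      ((C * Nat.card D.carrier ^ Nat.card X.carrier : ℕ) : ℕ∞))
    (hD : Subsingleton (H.obj D)) (X : FinCorr.{v}) : Subsingleton (H.obj X) := by
  induction hn : Nat.card X.carrier using Nat.strong_induction_on generalizing X with
  | _ n ih =>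
  subst hn
  by_contra hX
  rw [not_subsingleton_iff_nontrivial] at hX
  rcases le_or_gt (Nat.card X.carrier) (Nat.card D.carrier) with h | h
  · exact not_subsingleton _ (subsingleton_of_card_le H h hD)
  · obtain ⟨n, hn⟩ := exists_lt_pow hD0 h C
    -- The induction hypothesis makes `X` a smallest set of nonvanishing, so the lower growth bound
    -- applies to it.
    let N : FinCorr.{v} := ⟨ULift.{v} (Fin n)⟩
    have hN : Nat.card N.carrier = n := by simp [N]
    have h1 := (card_pow_le_length H X N fun Y hY => ih _ hY Y rfl).trans (hlen _)
    have h2 : Nat.card (FinCorr.sum X N).carrier = Nat.card X.carrier + n := by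
      rw [← hN]
      exact Nat.card_sum
    rw [h2, hN] at h1
    exact absurd (Nat.cast_le.mp h1) (not_le.mpr hn)

/-- `Q` is a quotient of the power `(k ⧸ J) ^ ι`. -/
theorem length_le_of_span {Q : Type*} [AddCommGroup Q] [Module k Q] (J : Ideal k)
    (hJ : ∀ r ∈ J, ∀ q : Q, r • q = 0) {ι : Type*} [Finite ι] (s : ι → Q)
    (hs : Submodule.span k (Set.range s) = ⊤) :
    Module.length k Q ≤ Nat.card ι * Module.length k (k ⧸ J) := by
  classical
  have := Fintype.ofFinite ι
  let f : (ι → k ⧸ J) →ₗ[k] Q := LinearMap.lsum k (fun _ => k ⧸ J) k fun i =>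
    Submodule.liftQ J (LinearMap.toSpanSingleton k Q (s i)) fun r hr => hJ r hr _
  have hf : Function.Surjective f := by
    rw [← LinearMap.range_eq_top, eq_top_iff, ← hs, Submodule.span_le]
    rintro _ ⟨i, rfl⟩
    refine ⟨Pi.single i (Submodule.Quotient.mk 1), ?_⟩
    rw [LinearMap.lsum_piSingle]
    exact one_smul k (s i)
  refine (Module.length_le_of_surjective f hf).trans_eq ?_
  rw [Module.length_pi, ENat.card_eq_coe_natCard]

/-- Every prime of `k ⧸ m ^ n` pulls back to `m`, so this noetherian ring has dimension at most zero
and is artinian. -/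
theorem length_quotient_pow_ne_top [IsNoetherianRing k] (m : Ideal k) [m.IsMaximal] (n : ℕ) :
    Module.length k (k ⧸ m ^ n) ≠ ⊤ := by
  have : Ring.KrullDimLE 0 (k ⧸ m ^ n) := by
    refine Ring.KrullDimLE.mk₀ fun p hp => ?_
    have h1 : (p.comap (Ideal.Quotient.mk (m ^ n))).IsMaximal := by
      have hle : m ≤ p.comap (Ideal.Quotient.mk (m ^ n)) := by
        refine Ideal.IsPrime.le_of_pow_le (n := n) fun x hx => ?_
        rw [Ideal.mem_comap, Ideal.Quotient.eq_zero_iff_mem.mpr hx]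
        exact p.zero_mem
      rw [← Ideal.IsMaximal.eq_of_le ‹m.IsMaximal› (Ideal.IsPrime.ne_top inferInstance) hle]
      infer_instance
    rw [← Ideal.map_comap_of_surjective _ Ideal.Quotient.mk_surjective p]
    exact Ideal.IsMaximal.map_of_surjective_of_ker_le Ideal.Quotient.mk_surjective
      (Ideal.ker_le_comap _)
  have : IsArtinianRing (k ⧸ m ^ n) := IsNoetherianRing.isArtinianRing_of_krullDimLE_zero
  have h := Module.length_ne_top (R := k ⧸ m ^ n) (M := k ⧸ m ^ n)
  rwa [Module.length_eq_of_surjective (R := k ⧸ m ^ n) (S := k) (M := k ⧸ m ^ n)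
    Ideal.Quotient.mk_surjective]

/-- A proper submodule of a finitely generated module is proper modulo some maximal ideal. -/
theorem exists_maximal_not_le {V : Type*} [AddCommGroup V] [Module k V] {N L : Submodule k V}
    (hN : N.FG) (h : ¬ N ≤ L) : ∃ m : Ideal k, m.IsMaximal ∧ ¬ N ≤ L ⊔ m • N := by
  have : Module.Finite k N := Module.Finite.iff_fg.mpr hN
  have hne : L.submoduleOf N ≠ ⊤ := fun e => h (Submodule.comap_subtype_eq_top.mp e)
  -- A maximal submodule `K` containing `L ∩ N` has simple quotient, and the annihilator of that
  -- quotient is the ideal sought.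
  obtain ⟨K, hK, hLK⟩ := (eq_top_or_exists_le_coatom (L.submoduleOf N)).resolve_left hne
  have : IsSimpleModule k (N ⧸ K) := isSimpleModule_iff_isCoatom.mpr hK
  refine ⟨Module.annihilator k (N ⧸ K), IsSimpleModule.annihilator_isMaximal, fun hle => ?_⟩
  refine hK.1 (eq_top_iff.mpr fun x _ => ?_)
  obtain ⟨l, hl, z, hz, hlz⟩ := Submodule.mem_sup.mp (hle x.2)
  have hz' : z ∈ K.map N.subtype := by
    refine Submodule.smul_le.mpr (fun r hr y hy => ?_) hz
    refine ⟨r • ⟨y, hy⟩, ?_, rfl⟩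
    rw [SetLike.mem_coe, ← Submodule.Quotient.mk_eq_zero, Submodule.Quotient.mk_smul]
    exact Module.mem_annihilator.mp hr _
  obtain ⟨z', hz', rfl⟩ := hz'
  have hl' : x - z' ∈ K := hLK (by
    change ((x - z' : N) : V) ∈ L
    rw [Submodule.coe_sub, ← hlz]
    simpa using hl)
  simpa using K.add_mem hl' hz'

/-- The subfunctor `S + I G` for an ideal `I`. -/
def Sub.supSmul {G : FinCorr.{v} ⥤ ModuleCat.{w} k} (S : Sub G) (I : Ideal k) : Sub G where
  obj X := S.obj X ⊔ I • ⊤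
  act_mem {X Y} U x hx := by
    have h : (S.obj X ⊔ I • ⊤).map (act G U) ≤ S.obj Y ⊔ I • ⊤ := by
      rw [Submodule.map_sup, Submodule.map_smul'']
      refine sup_le_sup ?_ (smul_mono_right _ le_top)
      exact Submodule.map_le_iff_le_comap.mpr fun x hx => S.act_mem U hx
    exact h ⟨x, hx, rfl⟩

/-- Subfunctors of a finitely generated functor generated at `E` are generated at `D`, where
`|D| = 2 ^ |E|`. -/
theorem Sub.le_generated_of_finite [IsNoetherianRing k] {G : FinCorr.{v} ⥤ ModuleCat.{w} k}
    {E D : FinCorr.{v}} {A : Set (G.obj E)} (hA : A.Finite)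
    (hG : ∀ X, (generated G E A).obj X = ⊤) (hD : Nat.card D.carrier = 2 ^ Nat.card E.carrier)
    (S : Sub G) (X : FinCorr.{v}) : S.obj X ≤ (generated G D (S.obj D)).obj X := by
  have : Finite A := hA
  have : Module.Finite k (G.obj X) := finite_obj_of_generated hA X (hG X)
  by_contra hX
  obtain ⟨m, hm, hmX⟩ := exists_maximal_not_le (IsNoetherian.noetherian _) hX
  -- Artin-Rees; one power beyond `j` leaves a factor `m` on `S(X)`.
  obtain ⟨j, hj⟩ := Ideal.exists_pow_inf_eq_pow_smul m (S.obj X)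
  have hAR : m ^ (j + 1) • ⊤ ⊓ S.obj X ≤ m • S.obj X := by
    rw [hj (j + 1) (Nat.le_succ j), Nat.add_sub_cancel_left, pow_one]
    exact smul_mono_right _ inf_le_right
  obtain ⟨c, hc⟩ := ENat.ne_top_iff_exists.mp (length_quotient_pow_ne_top m (j + 1))
  -- Working modulo `m ^ (j + 1)` makes all lengths finite, and `S / (S ∩ B)` vanishes at `D` by
  -- construction.
  let B := (generated G D (S.obj D)).supSmul (m ^ (j + 1))
  have hlen : ∀ Y : FinCorr.{v}, Module.length k ((S.quotient B).obj Y) ≤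
      ((Nat.card A * c * Nat.card D.carrier ^ Nat.card Y.carrier : ℕ) : ℕ∞) := by
    intro Y
    refine (S.length_quotient_le B Y).trans ?_
    refine (length_le_of_span (m ^ (j + 1)) ?_
      (fun p : (E ⟶ Y) × A => (B.obj Y).mkQ (act G p.1 p.2)) ?_).trans_eq ?_
    · intro r hr q
      obtain ⟨q, rfl⟩ := Submodule.mkQ_surjective _ q
      rw [← map_smul, Submodule.mkQ_apply, Submodule.Quotient.mk_eq_zero]
      exact Submodule.mem_sup_right (Submodule.smul_mem_smul hr trivial)
    · rw [Set.range_comp' (B.obj Y).mkQ, ← Submodule.map_span]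
      rw [show Submodule.span k (Set.range fun p : (E ⟶ Y) × A => act G p.1 p.2) = ⊤ from ?_,
        Submodule.map_top, Submodule.range_mkQ]
      rw [← hG Y]
      refine congrArg _ (Set.ext fun y => ?_)
      constructor
      · rintro ⟨p, rfl⟩
        exact ⟨p.1, p.2, p.2.2, rfl⟩
      · rintro ⟨U, a, ha, rfl⟩
        exact ⟨(U, ⟨a, ha⟩), rfl⟩
    -- The size of `D` is chosen so that the number of correspondences from `E` to `Y` is `|D| ^
    -- |Y|`.
    · have hcard : Nat.card (E ⟶ Y) = 2 ^ (Nat.card Y.carrier * Nat.card E.carrier) := by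
        have := Fintype.ofFinite (Y.carrier × E.carrier)
        change Nat.card (Set (Y.carrier × E.carrier)) = _
        rw [← Nat.card_prod, Nat.card_eq_fintype_card, Nat.card_eq_fintype_card,
          Fintype.card_set]
      rw [← hc, Nat.card_prod, hcard, hD, ← pow_mul, mul_comm (Nat.card E.carrier)]
      push_cast
      ring
  have hzero := subsingleton_of_length_le (S.quotient B) D (by rw [hD]; positivity) _ hlen
    ((S.subsingleton_quotient_iff B D).mpr fun x hx =>
      Submodule.mem_sup_left (mem_generated G hx)) X
  rw [Sub.subsingleton_quotient_iff] at hzero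
  refine hmX fun x hx => ?_
  obtain ⟨y, hy, z, hz, rfl⟩ := Submodule.mem_sup.mp (hzero hx)
  have hyS : y ∈ S.obj X := generated_le S subset_rfl X hy
  -- Both `y` and `y + z` lie in `S(X)`, so `z` does too and Artin-Rees puts it in `m • S(X)`.
  exact Submodule.add_mem_sup hy (hAR ⟨hz, by simpa using Submodule.sub_mem _ hx hyS⟩)

/-- Subfunctors of a functor generated at `E` are generated at `D`, where `|D| = 2 ^ |E|`. -/
theorem Sub.le_generated [IsNoetherianRing k] {G : FinCorr.{v} ⥤ ModuleCat.{w} k}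
    {E D : FinCorr.{v}} (hG : ∀ X, (generated G E Set.univ).obj X = ⊤)
    (hD : Nat.card D.carrier = 2 ^ Nat.card E.carrier) (S : Sub G) (X : FinCorr.{v}) :
    S.obj X ≤ (generated G D (S.obj D)).obj X := by
  intro x hx
  -- A single element involves finitely many generators; replacing `G` by the subfunctor they
  -- generate reduces to the finite case.
  obtain ⟨A, hA, hxA⟩ : ∃ A : Set (G.obj E), A.Finite ∧ x ∈ (generated G E A).obj X := by
    have hx' : x ∈ (generated G E Set.univ).obj X := by rw [hG]; trivial
    obtain ⟨t, ht, hxt⟩ := Submodule.mem_span_finite_of_mem_span hx'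
    choose U a _ ha using fun y : t => ht y.2
    refine ⟨Set.range a, Set.finite_range a, Submodule.span_mono (fun y hy => ?_) hxt⟩
    exact ⟨U ⟨y, hy⟩, a ⟨y, hy⟩, ⟨_, rfl⟩, ha ⟨y, hy⟩⟩
  let P := generated G E A
  let A' : Set (P.toFunctor.obj E) := (P.obj E).subtype ⁻¹' A
  have hA' : A'.Finite := Set.Finite.preimage Subtype.val_injective.injOn hA
  have hP : ∀ Y, (generated P.toFunctor E A').obj Y = ⊤ := by
    intro Y
    rw [eq_top_iff]
    rintro ⟨y, hy⟩ -
    induction hy using Submodule.span_induction with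
    | mem y hy =>
      obtain ⟨U, a, ha, rfl⟩ := hy
      exact act_mem_generated P.toFunctor (A := A') U (a := ⟨a, mem_generated G ha⟩) ha
    | zero => exact Submodule.zero_mem _
    | add y z hy hz ihy ihz => exact Submodule.add_mem _ ihy ihz
    | smul r y hy ih => exact Submodule.smul_mem _ r ih
  let S' : Sub P.toFunctor :=
    { obj := fun Y => (S.obj Y).comap (P.obj Y).subtype
      act_mem := fun U _ hx => S.act_mem U hx }
  have key := S'.le_generated_of_finite hA' hP hD X (x := ⟨x, hxA⟩) hx
  have hle : (generated P.toFunctor D (S'.obj D)).obj X ≤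
      ((generated G D (S.obj D)).obj X).comap (P.obj X).subtype := by
    refine Submodule.span_le.mpr ?_
    rintro _ ⟨U, a, ha, rfl⟩
    exact act_mem_generated G U ha
  exact hle key

end CorrAction

/-! ### Generation of shifts, finite powers and embedded functors -/

namespace CorrAction

open FinCorr

variable {k : Type u} [CommRing k]

theorem generated_mono (G : FinCorr.{v} ⥤ ModuleCat.{w} k) {E : FinCorr.{v}}
    {A A' : Set (G.obj E)} (h : A ⊆ A') (X : FinCorr.{v}) :
    (generated G E A).obj X ≤ (generated G E A').obj X :=
  generated_le _ (fun _ ha => mem_generated G (h ha)) X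

/-- The shift of a functor generated at `E` is generated by the elements of
`G(E ⊔ F)` obtained from generators in `G(E)`. -/
theorem generated_sumRight {G : FinCorr.{v} ⥤ ModuleCat.{w} k} {E : FinCorr.{v}}
    {A : Set (G.obj E)} (hG : ∀ X, (generated G E A).obj X = ⊤) (F X : FinCorr.{v}) :
    (generated (sumRight F ⋙ G) E
      (Set.range fun p : (E ⟶ FinCorr.sum E F) × A => act G p.1 p.2)).obj X = ⊤ := by
  rw [eq_top_iff]
  refine (hG (FinCorr.sum X F)).ge.trans (Submodule.span_le.mpr ?_)
  rintro _ ⟨U, a, ha, rfl⟩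
  -- `V` keeps `E` and records the part of `U` landing in `F`; `W` then carries out the part landing
  -- in `X`.
  let V : E ⟶ FinCorr.sum E F := ofRel (Y := FinCorr.sum E F)
    (Sum.elim (fun e e' => e = e') fun f e => Rel U (Sum.inr f) e)
  let W : E ⟶ X := ofRel fun x e => Rel U (Sum.inl x) e
  have hU : V ≫ sumMap W (𝟙 F) = U := by
    refine hom_ext_rel fun y e => ⟨?_, fun h => ?_⟩
    · rintro ⟨z, (⟨x, e', h1, h2⟩ | ⟨f, f', h1, h2⟩), h3⟩
      · obtain ⟨rfl, rfl⟩ := Prod.ext_iff.mp h2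
        obtain rfl : e' = e := h3
        exact h1
      · obtain ⟨rfl, rfl⟩ := Prod.ext_iff.mp h2
        obtain rfl : f = f' := h1
        exact h3
    · rcases y with x | f
      · exact ⟨Sum.inl e, Or.inl ⟨x, e, h, rfl⟩, rfl⟩
      · exact ⟨Sum.inr f, Or.inr ⟨f, f, rfl, rfl⟩, h⟩
  rw [← hU, act_comp]
  exact act_mem_generated (sumRight F ⋙ G) W ⟨(V, ⟨a, ha⟩), rfl⟩

/-- The product of copies of a functor. -/
def pi (G : FinCorr.{v} ⥤ ModuleCat.{w} k) (ι : Type w) : FinCorr.{v} ⥤ ModuleCat.{w} k where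
  obj X := ModuleCat.of k (ι → G.obj X)
  map U := ModuleCat.ofHom ((act G U).compLeft ι)
  map_id X := by
    refine ModuleCat.hom_ext (LinearMap.ext fun x => funext fun i => ?_)
    exact act_id G (x i)
  map_comp U V := by
    refine ModuleCat.hom_ext (LinearMap.ext fun x => funext fun i => ?_)
    exact act_comp G U V (x i)

open Classical in
theorem generated_pi {G : FinCorr.{v} ⥤ ModuleCat.{w} k} {E : FinCorr.{v}} {A : Set (G.obj E)}
    (hG : ∀ X, (generated G E A).obj X = ⊤) (ι : Type w) [Finite ι] (X : FinCorr.{v}) :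
    (generated (pi G ι) E
      (Set.range fun p : ι × A => (Pi.single p.1 p.2.1 : ι → G.obj E))).obj X = ⊤ := by
  have := Fintype.ofFinite ι
  rw [eq_top_iff]
  rintro (x : ι → G.obj X) -
  rw [← Finset.univ_sum_single x]
  refine Submodule.sum_mem _ fun i _ => ?_
  have hx : x i ∈ (generated G E A).obj X := by rw [hG]; trivial
  refine (Submodule.span_le (p := ((generated (pi G ι) E (Set.range fun p : ι × A =>
    (Pi.single p.1 p.2.1 : ι → G.obj E))).obj X).comap
      (LinearMap.single k (fun _ : ι => G.obj X) i))).mpr ?_ hx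
  rintro _ ⟨U, a, ha, rfl⟩
  have h : (Pi.single i (act G U a) : ι → G.obj X) = act (pi G ι) U
      (Pi.single i a : ι → G.obj E) := by
    funext j
    exact (Pi.apply_single (fun _ => act G U) (fun _ => map_zero _) i a j).symm
  have hm : act (pi G ι) U (Pi.single i a : ι → G.obj E) ∈ (generated (pi G ι) E
      (Set.range fun p : ι × A => (Pi.single p.1 p.2.1 : ι → G.obj E))).obj X :=
    act_mem_generated (pi G ι) U ⟨(i, ⟨a, ha⟩), rfl⟩
  rw [← h] at hm
  exact hm

theorem exists_finite_generated_pi_sumRight {G : FinCorr.{v} ⥤ ModuleCat.{w} k} {E : FinCorr.{v}}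
    {A : Set (G.obj E)} (hA : A.Finite) (hG : ∀ X, (generated G E A).obj X = ⊤) (F : FinCorr.{v})
    (ι : Type w) [Finite ι] : ∃ B : Set ((pi (sumRight F ⋙ G) ι).obj E), B.Finite ∧
      ∀ X, (generated (pi (sumRight F ⋙ G) ι) E B).obj X = ⊤ := by
  have : Finite A := hA
  have hB := Set.finite_range fun p : (E ⟶ FinCorr.sum E F) × A => act G p.1 p.2
  have := hB.to_subtype
  classical
  refine ⟨_, ?_, generated_pi (G := sumRight F ⋙ G) (generated_sumRight hG F) ι⟩
  exact @Set.finite_range _ _ _ (@Finite.instProd _ _ _ this)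

section embedding

universe w₁ w₂

variable {L : FinCorr.{v} ⥤ ModuleCat.{w₁} k} {P : FinCorr.{v} ⥤ ModuleCat.{w₂} k}
  (ι : ∀ X, L.obj X →ₗ[k] P.obj X) (hinj : ∀ X, Function.Injective (ι X))
  (hι : ∀ {X Y : FinCorr.{v}} (U : X ⟶ Y) (x : L.obj X), ι Y (act L U x) = act P U (ι X x))

include hinj hι

/-- Over a noetherian ring, a functor that embeds in a functor generated at `E` is generated at
`D`, where `|D| = 2 ^ |E|`. -/
theorem generated_of_injective [IsNoetherianRing k] {E D : FinCorr.{v}}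
    (hP : ∀ X, (generated P E Set.univ).obj X = ⊤)
    (hD : Nat.card D.carrier = 2 ^ Nat.card E.carrier) (X : FinCorr.{v}) :
    (generated L D Set.univ).obj X = ⊤ := by
  let S : Sub P :=
    { obj := fun X => LinearMap.range (ι X)
      act_mem := by
        rintro X Y U _ ⟨x, rfl⟩
        exact ⟨act L U x, hι U x⟩ }
  refine eq_top_iff.mpr fun x _ => ?_
  have hle : (generated P D (S.obj D)).obj X ≤ ((generated L D Set.univ).obj X).map (ι X) := by
    refine Submodule.span_le.mpr ?_
    rintro _ ⟨U, _, ⟨y, rfl⟩, rfl⟩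
    exact ⟨act L U y, act_mem_generated L U trivial, hι U y⟩
  obtain ⟨y, hy, hyx⟩ := hle (S.le_generated hP hD X ⟨x, rfl⟩)
  rwa [← hinj X hyx]

/-- Over a noetherian ring, a functor that embeds in a finitely generated functor is finitely
generated. -/
theorem exists_finite_generated_of_injective [IsNoetherianRing k] {E D : FinCorr.{v}}
    {A : Set (P.obj E)} (hA : A.Finite) (hP : ∀ X, (generated P E A).obj X = ⊤)
    (hD : Nat.card D.carrier = 2 ^ Nat.card E.carrier) :
    ∃ A' : Set (L.obj D), A'.Finite ∧ ∀ X, (generated L D A').obj X = ⊤ := by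
  -- The value at `D` is a submodule of a finitely generated module over a noetherian ring, and it
  -- generates `L`.
  have : Module.Finite k (P.obj D) := finite_obj_of_generated hA D (hP D)
  have : Module.Finite k (L.obj D) := Module.Finite.of_injective (ι D) (hinj D)
  obtain ⟨A', hA', hspan⟩ := Submodule.fg_def.mp (Module.Finite.fg_top (R := k) (M := L.obj D))
  refine ⟨A', hA', fun X => eq_top_iff.mpr ?_⟩
  rw [← generated_of_injective ι hinj hι (fun X => eq_top_iff.mpr
    ((hP X).ge.trans (generated_mono P (Set.subset_univ A) X))) hD X]
  refine generated_le _ (fun x _ => ?_) X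
  have hx : x ∈ Submodule.span k A' := by rw [hspan]; trivial
  exact Submodule.span_le.mpr (fun a ha => mem_generated L ha) hx

end embedding

end CorrAction

/-! ### Symmetry of the disjoint union -/

namespace FinCorr

/-- The symmetry of the disjoint union. -/
def swap (X Y : FinCorr.{v}) : FinCorr.sum X Y ⟶ FinCorr.sum Y X :=
  ofRel (X := FinCorr.sum X Y) (Y := FinCorr.sum Y X) fun b a => b = Sum.swap a

theorem swap_swap (X Y : FinCorr.{v}) : swap X Y ≫ swap Y X = 𝟙 _ := by
  refine hom_ext_rel fun a b => ⟨?_, ?_⟩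
  · rintro ⟨c, h1, h2⟩
    obtain rfl : c = Sum.swap b := h2
    exact h1.trans (Sum.swap_swap b)
  · intro h
    obtain rfl : a = b := h
    exact ⟨Sum.swap a, (Sum.swap_swap a).symm, rfl⟩

theorem sumMap_swap_id {X Y : FinCorr.{v}} (E : FinCorr.{v}) (V : X ⟶ Y) :
    sumMap (𝟙 E) V ≫ swap E Y = swap E X ≫ sumMap V (𝟙 E) := by
  refine hom_ext_rel fun a b => ⟨?_, ?_⟩
  · rintro ⟨c, h3, (⟨x, e, h1, h2⟩ | ⟨f, f', h1, h2⟩)⟩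
    · obtain ⟨rfl, rfl⟩ := Prod.ext_iff.mp h2
      obtain rfl : a = Sum.inr x := h3
      exact ⟨Sum.inr e, Or.inr ⟨x, e, h1, rfl⟩, rfl⟩
    · obtain ⟨rfl, rfl⟩ := Prod.ext_iff.mp h2
      obtain rfl : a = Sum.inl f := h3
      exact ⟨Sum.inl f', Or.inl ⟨f, f', h1, rfl⟩, rfl⟩
  · rintro ⟨_, (⟨x, e, h1, h2⟩ | ⟨f, f', h1, h2⟩), h3⟩
    · obtain ⟨rfl, rfl⟩ := Prod.ext_iff.mp h2
      obtain ⟨c⟩ | ⟨c⟩ := b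
      · cases h3
      · cases h3
        exact ⟨Sum.inr x, rfl, Or.inr ⟨x, e, h1, rfl⟩⟩
    · obtain ⟨rfl, rfl⟩ := Prod.ext_iff.mp h2
      obtain ⟨c⟩ | ⟨c⟩ := b
      · cases h3
        exact ⟨Sum.inl f, rfl, Or.inl ⟨f, f', h1, rfl⟩⟩
      · cases h3

end FinCorr

namespace CorrAction

open FinCorr

variable {k : Type u} [CommRing k]

theorem act_swap_injective (G : FinCorr.{v} ⥤ ModuleCat.{w} k)
    (X Y : FinCorr.{v}) : Function.Injective (act G (swap X Y)) :=
  Function.LeftInverse.injective (g := act G (swap Y X)) fun x => by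
    rw [← act_comp, swap_swap, act_id]

theorem act_swap_act_sumMap (G : FinCorr.{v} ⥤ ModuleCat.{w} k)
    (E : FinCorr.{v}) {X Y : FinCorr.{v}} (V : X ⟶ Y) (x : G.obj (FinCorr.sum E X)) :
    act G (swap E Y) (act G (sumMap (𝟙 E) V) x) =
      act G (sumMap V (𝟙 E)) (act G (swap E X) x) := by
  rw [← act_comp, ← act_comp, sumMap_swap_id]

end CorrAction

/-! ### Back to correspondence functors: evaluation and the theorem -/

namespace CorrFunctor

open FinCorr CorrAction

variable {k : Type u} [CommRing k]

/-- The underlying functor on correspondences. -/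
noncomputable def restrict (M : CorrFunctor.{u, v, w} k) : FinCorr.{v} ⥤ ModuleCat.{w} k :=
  Free.embedding k FinCorr.{v} ⋙ M.toFunctor

/-- A combination of correspondences acts as the same combination of their actions, so generation
over `k𝒞` can be tested with single correspondences. -/
theorem generatedBy_iff (M : CorrFunctor.{u, v, w} k) (E : FinCorr.{v}) (A : Set (M.val E)) :
    M.GeneratedBy E A ↔ ∀ X, (generated M.restrict E A).obj X = ⊤ := by
  refine forall_congr' fun X => ?_
  suffices h : Submodule.span k {y : M.val X | ∃ f : (Free.embedding k FinCorr.{v}).obj E ⟶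
      (Free.embedding k FinCorr.{v}).obj X, ∃ a ∈ A, y = M.toFunctor.map f a} =
      (generated M.restrict E A).obj X by rw [h]; rfl
  refine le_antisymm (Submodule.span_le.mpr ?_) (Submodule.span_mono ?_)
  · rintro _ ⟨f, a, ha, rfl⟩
    induction f using KLin.hom_induction with
    | h0 =>
      rw [Functor.map_zero]
      exact Submodule.zero_mem _
    | hadd f g hf hg =>
      rw [Functor.map_add]
      exact Submodule.add_mem _ hf hg
    | hs r g =>
      rw [Functor.map_smul]
      exact Submodule.smul_mem _ r (act_mem_generated M.restrict g ha)
  · rintro _ ⟨U, a, ha, rfl⟩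
    exact ⟨(Free.embedding k FinCorr.{v}).map U, a, ha, rfl⟩

theorem act_restrict_shift (M : CorrFunctor.{u, v, w} k) (F : FinCorr.{v}) {X Y : FinCorr.{v}}
    (U : X ⟶ Y) : act (M.shift F).restrict U = act (sumRight F ⋙ M.restrict) U :=
  congrArg (fun f => (M.toFunctor.map f).hom)
    (KLin.lift_map_embedding (k := k) (sumRight F ⋙ Free.embedding k FinCorr.{v}) U)

theorem act_restrict_ihom (M N : CorrFunctor.{u, v, w} k) {X Y : FinCorr.{v}} (U : X ⟶ Y) :
    act (M.ihom N).restrict U = act (ihomAux M N) U :=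
  congrArg ModuleCat.Hom.hom (KLin.lift_map_embedding (k := k) (ihomAux M N) U)

theorem shift_generatedBy_iff (M : CorrFunctor.{u, v, w} k) (E F : FinCorr.{v})
    (A : Set ((M.shift F).val E)) :
    (M.shift F).GeneratedBy E A ↔
      ∀ X, (generated (sumRight F ⋙ M.restrict) E A).obj X = ⊤ := by
  rw [generatedBy_iff]
  refine forall_congr' fun X => ?_
  simp only [generated, act_restrict_shift]
  rfl

theorem ihom_generatedBy_iff (M N : CorrFunctor.{u, v, w} k) (E : FinCorr.{v})
    (A : Set ((M.ihom N).val E)) :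
    (M.ihom N).GeneratedBy E A ↔ ∀ X, (generated (ihomAux M N) E A).obj X = ⊤ := by
  rw [generatedBy_iff]
  refine forall_congr' fun X => ?_
  simp only [generated, act_restrict_ihom]
  rfl

/-- Evaluation of morphisms `M ⟶ N_X` at elements of `M(E)`. -/
noncomputable def evalAt (M N : CorrFunctor.{u, v, w} k) (E : FinCorr.{v}) (A : Set (M.val E))
    (X : FinCorr.{v}) :
    (ihomAux M N).obj X →ₗ[k] (CorrAction.pi (sumRight E ⋙ N.restrict) A).obj X where
  toFun α := show A → N.restrict.obj (FinCorr.sum X E) from fun a =>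
    act N.restrict (swap E X)
      (((show Hom M (N.shift X) from α).app ((Free.embedding k FinCorr.{v}).obj E)).hom a.1)
  map_add' _ _ := funext fun _ => map_add (act N.restrict (swap E X)) _ _
  map_smul' r _ := funext fun _ => map_smul (act N.restrict (swap E X)) r _

/-- By naturality a morphism is determined by its values on generators, and the swap is invertible.
-/
theorem evalAt_injective (M N : CorrFunctor.{u, v, w} k) (E : FinCorr.{v}) (A : Set (M.val E))
    (hM : M.GeneratedBy E A) (X : FinCorr.{v}) : Function.Injective (evalAt M N E A X) := by
  intro α β h
  change Hom M (N.shift X) at α β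
  refine NatTrans.ext (funext fun Y => ModuleCat.hom_ext (LinearMap.ext_on (hM Y) ?_))
  rintro _ ⟨f, a, ha, rfl⟩
  have h1 : act N.restrict (swap E X)
        ((α.app ((Free.embedding k FinCorr.{v}).obj E)).hom a) =
      act N.restrict (swap E X)
        ((β.app ((Free.embedding k FinCorr.{v}).obj E)).hom a) := congrFun h ⟨a, ha⟩
  have h2 := act_swap_injective N.restrict E X h1
  have hα := LinearMap.congr_fun (congrArg ModuleCat.Hom.hom (α.naturality f)) a
  have hβ := LinearMap.congr_fun (congrArg ModuleCat.Hom.hom (β.naturality f)) a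
  refine hα.trans (Eq.trans ?_ hβ.symm)
  exact congrArg ((N.shift X).toFunctor.map f).hom h2

/-- `V` acts on the second summand of `N(E ⊔ X)`; the swap moves it to the first, where the shift
`N_E` has its variable. -/
theorem evalAt_act (M N : CorrFunctor.{u, v, w} k) (E : FinCorr.{v}) (A : Set (M.val E))
    {X Y : FinCorr.{v}} (V : X ⟶ Y) (α : (ihomAux M N).obj X) :
    evalAt M N E A Y (act (ihomAux M N) V α) =
      act (CorrAction.pi (sumRight E ⋙ N.restrict) A) V (evalAt M N E A X α) := by
  funext a
  exact act_swap_act_sumMap N.restrict E V _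

theorem GeneratedAt.shift {M : CorrFunctor.{u, v, w} k} {E : FinCorr.{v}} (h : M.GeneratedAt E)
    (F : FinCorr.{v}) : (M.shift F).GeneratedAt E := by
  refine (shift_generatedBy_iff M E F _).mpr fun X => eq_top_iff.mpr ?_
  exact (generated_sumRight ((generatedBy_iff M E _).mp h) F X).ge.trans
    (generated_mono _ (Set.subset_univ _) X)

theorem FinitelyGenerated.shift {M : CorrFunctor.{u, v, w} k} (h : M.FinitelyGenerated)
    (F : FinCorr.{v}) : (M.shift F).FinitelyGenerated := by
  obtain ⟨E, A, hA, hM⟩ := h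
  have : Finite (@Set.Elem (M.restrict.obj E) A) := hA
  exact ⟨E, _, Set.finite_range _, (shift_generatedBy_iff M E F _).mpr
    (generated_sumRight ((generatedBy_iff M E A).mp hM) F)⟩

theorem exists_card_two_pow (E : FinCorr.{v}) :
    ∃ D : FinCorr.{v}, Nat.card D.carrier = 2 ^ Nat.card E.carrier := by
  have := Fintype.ofFinite E.carrier
  refine ⟨⟨Set E.carrier⟩, ?_⟩
  rw [Nat.card_eq_fintype_card, Nat.card_eq_fintype_card, Fintype.card_set]

theorem BoundedType.ihom [IsNoetherianRing k] {M N : CorrFunctor.{u, v, w} k}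
    (hM : M.FinitelyGenerated) (hN : N.BoundedType) : (M.ihom N).BoundedType := by
  obtain ⟨F, A, hA, hM⟩ := hM
  obtain ⟨E, hN⟩ := hN
  have : Finite A := hA
  obtain ⟨D, hD⟩ := exists_card_two_pow E
  refine ⟨D, (ihom_generatedBy_iff M N D _).mpr ?_⟩
  refine generated_of_injective (evalAt M N F A) (evalAt_injective M N F A hM)
    (evalAt_act M N F A) (fun X => eq_top_iff.mpr ?_) hD
  exact (generated_pi (generated_sumRight ((generatedBy_iff N E _).mp hN) F) A X).ge.trans
    (generated_mono _ (Set.subset_univ _) X)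

theorem FinitelyGenerated.ihom [IsNoetherianRing k] {M N : CorrFunctor.{u, v, w} k}
    (hM : M.FinitelyGenerated) (hN : N.FinitelyGenerated) : (M.ihom N).FinitelyGenerated := by
  obtain ⟨F, A, hA, hM⟩ := hM
  obtain ⟨E, B, hB, hN⟩ := hN
  have : Finite A := hA
  obtain ⟨D, hD⟩ := exists_card_two_pow E
  obtain ⟨B', hB', hgen'⟩ := exists_finite_generated_pi_sumRight (G := N.restrict) hB
    ((generatedBy_iff N E B).mp hN) F A
  obtain ⟨C, hC, hgen⟩ := exists_finite_generated_of_injective (evalAt M N F A)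
    (evalAt_injective M N F A hM) (evalAt_act M N F A) hB' hgen' hD
  exact ⟨D, C, hC, (ihom_generatedBy_iff M N D C).mpr hgen⟩

end CorrFunctor

/-- Shifts and internal homs of correspondence functors: bounded type and finite generation. -/
theorem theorem6p8 {k : Type u} [CommRing k] (M N : CorrFunctor.{u, v, w} k) :
    (∀ E F : FinCorr.{v}, M.GeneratedAt E → (M.shift F).GeneratedAt E) ∧
    (∀ F : FinCorr.{v}, M.BoundedType → (M.shift F).BoundedType) ∧
    (∀ F : FinCorr.{v}, M.FinitelyGenerated → (M.shift F).FinitelyGenerated) ∧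
    (IsNoetherianRing k → M.FinitelyGenerated →
      (N.BoundedType → (CorrFunctor.ihom M N).BoundedType) ∧
      (N.FinitelyGenerated → (CorrFunctor.ihom M N).FinitelyGenerated)) := by
  refine ⟨fun E F h => h.shift F, fun F ⟨E, h⟩ => ⟨E, h.shift F⟩, fun F h => h.shift F,
    fun hk hM => ⟨fun hN => .ihom hM hN, fun hN => .ihom hM hN⟩⟩
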